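/- **Conventions.** All groups are abelian; a rank-1 group is a torsion-free abelian group of rank $1$. Let $\Pi$ be the set of primes. A characteristic is a sequence $(t_p)_{p\in\Pi}$ with $t_p\in\mathbb N\cup\{\infty\}$, $0 \in \mathbb N$; two characteristics are equivalent if they differ in only finitely many entries and both entries are finite wherever they differ. A type is an equivalence class of characteristics. The set $\mathcal T$ of all types is ordered by $\sigma\le\tau$ if there are representatives $(s_p)$ of $\sigma$ and $(t_p)$ of $\tau$ with $s_p\le t_p$ for all $p$; it is a lattice, with join and meet induced by the pointwise maximum and minimum. The type $t(T)$ of a rank-1 group $T$ is the class of $(h_p(x))_{p\in\Pi}$ for any $0\ne x\in T$, where $h_p(x)=\sup\{n \mid x\in p^nT\}$. A cotorsion theory is a pair $(\mathcal F,\mathcal C)$ of classes of abelian groups with $\mathcal F={}^\perp\mathcal C=\{Y\mid \operatorname{Ext}(Y,X)=0\ \text{for all } X\in\mathcal C\}$ and $\mathcal C=\mathcal F^\perp=\{X\mid\operatorname{Ext}(Y,X)=0\ \text{for all } Y\in\mathcal F\}$. Cotorsion theories are ordered by $(\mathcal F,\mathcal C)\le(\mathcal F',\mathcal C')$ if $\mathcal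 C\subseteq\mathcal C'$. A rational cotorsion theory is one of the form $({}^\perp(T^\perp),T^\perp)$ with $T$ a rank-1 group, where $T^\perp=\{X\mid\operatorname{Ext}(T,X)=0\}$. Let $\mathcal C_{\mathrm{rat}}$ be the collection of all rational cotorsion theories with the induced order. **Theorem 1.11.** The lattice of types $(\mathcal T,\le)$ is anti-isomorphic to the lattice of rational cotorsion theories $(\mathcal C_{\mathrm{rat}},\le)$ via the mapping $$\Phi:\ \tau=t(T)\longmapsto\bigl({}^\perp(T^\perp),\,T^\perp\bigr).$$ That is, $\Phi$ is a well-defined bijection $\mathcal T\to\mathcal C_{\mathrm{rat}}$ with $\sigma\le\tau$ if and only if $\Phi(\tau)\le\Phi(\sigma)$; in particular $\mathcal C_{\mathrm{rat}}$ is a lattice in its order, and, with infimum and supremum taken in $\mathcal C_{\mathrm{rat}}$, $\Phi(\sigma\vee\tau)=\Phi(\sigma)\wedge\Phi(\tau)$ and $\Phi(\sigma\wedge\tau)=\Phi(\sigma)\vee\Phi(\tau)$ for all types $\sigma,\tau$. -/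

import Mathlib

universe u

/-! ### Types -/

/-- A characteristic: a sequence `(t_p)`, indexed by the primes, with `t_p ∈ ℕ ∪ {∞}`. -/
abbrev Characteristic : Type := Nat.Primes → ℕ∞

namespace Characteristic

/-- Two characteristics are equivalent if they differ in only finitely many entries, and
both entries are finite wherever they differ. -/
def Equivalent (χ ψ : Characteristic) : Prop :=
  {p | χ p ≠ ψ p}.Finite ∧ ∀ p, χ p ≠ ψ p → χ p ≠ ⊤ ∧ ψ p ≠ ⊤

theorem equivalent_equivalence : Equivalence Equivalent where
  refl χ := ⟨by simp, fun p h => (h rfl).elim⟩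
  symm {χ ψ} h := ⟨by simpa only [ne_comm] using h.1, fun p hp => (h.2 p hp.symm).symm⟩
  trans {χ ψ ω} h k := by
    refine ⟨(h.1.union k.1).subset fun p hp => ?_, fun p hp => ?_⟩
    · by_contra hc
      simp only [Set.mem_union, Set.mem_ofPred_eq, not_or, not_not] at hc
      exact hp (hc.1.trans hc.2)
    · by_cases h1 : χ p = ψ p
      · by_cases h2 : ψ p = ω p
        · exact (hp (h1.trans h2)).elim
        · exact ⟨h1 ▸ (k.2 p h2).1, (k.2 p h2).2⟩
      · by_cases h2 : ψ p = ω p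
        · exact ⟨(h.2 p h1).1, h2 ▸ (h.2 p h1).2⟩
        · exact ⟨(h.2 p h1).1, (k.2 p h2).2⟩

instance setoid : Setoid Characteristic := ⟨Equivalent, equivalent_equivalence⟩

/-- `χ p ≤ ψ p` for all but finitely many `p`, and `χ p` is finite at the exceptions. -/
def AlmostLE (χ ψ : Characteristic) : Prop :=
  {p | ¬ χ p ≤ ψ p}.Finite ∧ ∀ p, ¬ χ p ≤ ψ p → χ p ≠ ⊤

theorem AlmostLE.of_le {χ ψ : Characteristic} (h : χ ≤ ψ) : AlmostLE χ ψ :=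
  ⟨by simp [show ∀ p, χ p ≤ ψ p from h], fun p hp => (hp (h p)).elim⟩

theorem AlmostLE.trans {χ ψ ω : Characteristic} (h : AlmostLE χ ψ) (k : AlmostLE ψ ω) :
    AlmostLE χ ω := by
  refine ⟨(h.1.union k.1).subset fun p hp => ?_, fun p hp => ?_⟩
  · by_contra hc
    simp only [Set.mem_union, Set.mem_ofPred_eq, not_or, not_not] at hc
    exact hp (hc.1.trans hc.2)
  · by_cases h1 : χ p ≤ ψ p
    · intro ht
      have h3 : ψ p = ⊤ := top_le_iff.1 (ht ▸ h1)
      exact k.2 p (fun h2 => hp (h1.trans h2)) h3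
    · exact h.2 p h1

theorem equivalent_iff {χ ψ : Characteristic} :
    Equivalent χ ψ ↔ AlmostLE χ ψ ∧ AlmostLE ψ χ := by
  constructor
  · rintro ⟨h, k⟩
    refine ⟨⟨h.subset fun p hp he => hp he.le, fun p hp => (k p fun he => hp he.le).1⟩,
      ⟨h.subset fun p hp he => hp he.ge, fun p hp => (k p fun he => hp he.ge).2⟩⟩
  · rintro ⟨⟨h1, k1⟩, ⟨h2, k2⟩⟩
    refine ⟨(h1.union h2).subset fun p hp => ?_, fun p hp => ?_⟩
    · rcases lt_or_gt_of_ne hp with h | h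
      · exact Or.inr h.not_ge
      · exact Or.inl h.not_ge
    · rcases lt_or_gt_of_ne hp with h | h
      · exact ⟨h.ne_top, k2 p h.not_ge⟩
      · exact ⟨k1 p h.not_ge, h.ne_top⟩

theorem AlmostLE.sup {χ ψ ω : Characteristic} (h : AlmostLE χ ω) (k : AlmostLE ψ ω) :
    AlmostLE (χ ⊔ ψ) ω := by
  refine ⟨(h.1.union k.1).subset fun p hp => ?_, fun p hp ht => ?_⟩
  · by_contra hc
    simp only [Set.mem_union, Set.mem_ofPred_eq, not_or, not_not] at hc
    exact hp (sup_le hc.1 hc.2)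
  · rw [Pi.sup_apply] at hp ht
    rcases le_total (χ p) (ψ p) with hle | hle
    · rw [sup_eq_right.2 hle] at hp ht
      exact k.2 p hp ht
    · rw [sup_eq_left.2 hle] at hp ht
      exact h.2 p hp ht

theorem AlmostLE.inf {χ ψ ω : Characteristic} (h : AlmostLE χ ψ) (k : AlmostLE χ ω) :
    AlmostLE χ (ψ ⊓ ω) := by
  refine ⟨(h.1.union k.1).subset fun p hp => ?_, fun p hp => ?_⟩
  · by_contra hc
    simp only [Set.mem_union, Set.mem_ofPred_eq, not_or, not_not] at hc
    exact hp (le_inf hc.1 hc.2)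
  · by_cases h1 : χ p ≤ ψ p
    · exact k.2 p fun h2 => hp (le_inf h1 h2)
    · exact h.2 p h1

theorem Equivalent.sup {χ χ' ψ ψ' : Characteristic} (h : Equivalent χ χ')
    (k : Equivalent ψ ψ') : Equivalent (χ ⊔ ψ) (χ' ⊔ ψ') := by
  rw [equivalent_iff] at *
  exact ⟨(h.1.trans (.of_le le_sup_left)).sup (k.1.trans (.of_le le_sup_right)),
    (h.2.trans (.of_le le_sup_left)).sup (k.2.trans (.of_le le_sup_right))⟩

theorem Equivalent.inf {χ χ' ψ ψ' : Characteristic} (h : Equivalent χ χ')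
    (k : Equivalent ψ ψ') : Equivalent (χ ⊓ ψ) (χ' ⊓ ψ') := by
  rw [equivalent_iff] at *
  exact ⟨(AlmostLE.trans (.of_le inf_le_left) h.1).inf (AlmostLE.trans (.of_le inf_le_right) k.1),
    (AlmostLE.trans (.of_le inf_le_left) h.2).inf (AlmostLE.trans (.of_le inf_le_right) k.2)⟩

end Characteristic

/-- A type is an equivalence class of characteristics. -/
def GroupType : Type := Quotient Characteristic.setoid

namespace GroupType

/-- The type represented by a characteristic. -/
def mk (χ : Characteristic) : GroupType := Quotient.mk _ χ

theorem mk_eq_mk {χ ψ : Characteristic} : mk χ = mk ψ ↔ χ.Equivalent ψ := Quotient.eq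

/-- `σ ≤ τ` if there are representatives with `s_p ≤ t_p` for all primes `p`. -/
instance : LE GroupType where
  le σ τ := ∃ χ ψ : Characteristic, mk χ = σ ∧ mk ψ = τ ∧ ∀ p, χ p ≤ ψ p

theorem mk_le_mk {χ ψ : Characteristic} : mk χ ≤ mk ψ ↔ χ.AlmostLE ψ := by
  constructor
  · rintro ⟨χ', ψ', h1, h2, h⟩
    rw [mk_eq_mk, Characteristic.equivalent_iff] at h1 h2
    exact h1.2.trans (.trans (.of_le h) h2.1)
  · intro h
    refine ⟨χ ⊓ ψ, ψ, ?_, rfl, fun p => inf_le_right⟩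
    rw [mk_eq_mk, Characteristic.equivalent_iff]
    exact ⟨.of_le inf_le_left, .inf (.of_le le_rfl) h⟩

/-- The lattice of types; joins and meets are induced by the pointwise maximum and minimum. -/
noncomputable instance : Lattice GroupType where
  le_refl σ := by
    induction σ using Quotient.inductionOn with | _ χ => exact ⟨χ, χ, rfl, rfl, fun _ => le_rfl⟩
  le_trans σ τ ρ := by
    induction σ using Quotient.inductionOn with | _ χ
    induction τ using Quotient.inductionOn with | _ ψ
    induction ρ using Quotient.inductionOn with | _ ω
    exact fun h k => mk_le_mk.2 ((mk_le_mk.1 h).trans (mk_le_mk.1 k))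
  le_antisymm σ τ := by
    induction σ using Quotient.inductionOn with | _ χ
    induction τ using Quotient.inductionOn with | _ ψ
    exact fun h k => mk_eq_mk.2 (Characteristic.equivalent_iff.2 ⟨mk_le_mk.1 h, mk_le_mk.1 k⟩)
  sup := Quotient.map₂ (· ⊔ ·) fun _ _ h _ _ k => Characteristic.Equivalent.sup h k
  inf := Quotient.map₂ (· ⊓ ·) fun _ _ h _ _ k => Characteristic.Equivalent.inf h k
  le_sup_left σ τ := by
    induction σ using Quotient.inductionOn with | _ χ
    induction τ using Quotient.inductionOn with | _ ψ
    exact mk_le_mk.2 (.of_le le_sup_left)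
  le_sup_right σ τ := by
    induction σ using Quotient.inductionOn with | _ χ
    induction τ using Quotient.inductionOn with | _ ψ
    exact mk_le_mk.2 (.of_le le_sup_right)
  sup_le σ τ ρ := by
    induction σ using Quotient.inductionOn with | _ χ
    induction τ using Quotient.inductionOn with | _ ψ
    induction ρ using Quotient.inductionOn with | _ ω
    exact fun h k => mk_le_mk.2 ((mk_le_mk.1 h).sup (mk_le_mk.1 k))
  inf_le_left σ τ := by
    induction σ using Quotient.inductionOn with | _ χ
    induction τ using Quotient.inductionOn with | _ ψ
    exact mk_le_mk.2 (.of_le inf_le_left)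
  inf_le_right σ τ := by
    induction σ using Quotient.inductionOn with | _ χ
    induction τ using Quotient.inductionOn with | _ ψ
    exact mk_le_mk.2 (.of_le inf_le_right)
  le_inf σ τ ρ := by
    induction σ using Quotient.inductionOn with | _ χ
    induction τ using Quotient.inductionOn with | _ ψ
    induction ρ using Quotient.inductionOn with | _ ω
    exact fun h k => mk_le_mk.2 ((mk_le_mk.1 h).inf (mk_le_mk.1 k))

end GroupType

/-! ### Rank-1 groups and their types -/

/-- A rank-1 group: a torsion-free abelian group of rank `1`. -/
structure IsRankOne (T : Type u) [AddCommGroup T] : Prop where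
  torsionFree : IsAddTorsionFree T
  rank_eq_one : Module.rank ℤ T = 1

/-- The `p`-height of `x`: the supremum in `ℕ ∪ {∞}` of all `n` such that `x ∈ pⁿ T`. -/
noncomputable def pHeight {T : Type u} [AddCommGroup T] (x : T) (p : Nat.Primes) : ℕ∞ :=
  ⨆ (n : ℕ) (_ : ∃ y : T, (p : ℕ) ^ n • y = x), (n : ℕ∞)

/-- The type of an element: the class of its sequence of heights. -/
noncomputable def elementType {T : Type u} [AddCommGroup T] (x : T) : GroupType :=
  GroupType.mk (pHeight x)

theorem IsRankOne.exists_ne_zero {T : Type u} [AddCommGroup T] (hT : IsRankOne T) :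
    ∃ x : T, x ≠ 0 := by
  by_contra! h
  have : Subsingleton T := ⟨fun a b => (h a).trans (h b).symm⟩
  have h1 := hT.rank_eq_one
  rw [rank_subsingleton'] at h1
  exact zero_ne_one h1

/-- The type `t(T)` of a rank-1 group `T`: the type of any nonzero element of `T`
(see `IsRankOne.type_eq` for the independence of the element). -/
noncomputable def IsRankOne.type {T : Type u} [AddCommGroup T] (hT : IsRankOne T) : GroupType :=
  elementType hT.exists_ne_zero.choose

theorem elementType_zsmul {T : Type u} [AddCommGroup T] [IsAddTorsionFree T] (x : T) (m : ℤ)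
    (hm : m ≠ 0) : elementType (m • x) = elementType x := by
  have key : ∀ p : Nat.Primes, pHeight (m • x) p ≤ pHeight x p + (padicValInt p m : ℕ∞) := by
    intro p
    have hp : Fact (p : ℕ).Prime := ⟨p.2⟩
    refine iSup₂_le fun n ⟨y, hy⟩ => ?_
    rcases le_total n (padicValInt p m) with h | h
    · exact le_trans (by exact_mod_cast h) le_add_self
    obtain ⟨k, rfl⟩ := Nat.exists_eq_add_of_le h
    obtain ⟨c, hc⟩ : ((p : ℕ) : ℤ) ^ padicValInt p m ∣ m := by
      rw [padicValInt_dvd_iff]; exact Or.inr le_rfl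
    have hcop : IsCoprime (((p : ℕ) : ℤ) ^ k) c := by
      refine IsCoprime.pow_left ((Nat.prime_iff_prime_int.1 p.2).coprime_iff_not_dvd.2 ?_)
      rintro ⟨d, hd⟩
      have h2 : ((p : ℕ) : ℤ) ^ (padicValInt p m + 1) ∣ m :=
        ⟨d, by rw [pow_succ, mul_assoc, ← hd]; exact hc⟩
      rw [padicValInt_dvd_iff] at h2
      omega
    have hy' : (((p : ℕ) : ℤ) ^ k) • y = c • x := by
      have h3 : (((p : ℕ) : ℤ) ^ padicValInt p m) • ((((p : ℕ) : ℤ) ^ k) • y) =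
          (((p : ℕ) : ℤ) ^ padicValInt p m) • (c • x) := by
        rw [smul_smul, smul_smul, ← pow_add, ← hc, ← hy]
        exact_mod_cast natCast_zsmul y _
      exact zsmul_right_injective (pow_ne_zero _ (by exact_mod_cast p.2.ne_zero)) h3
    obtain ⟨a, b, hab⟩ := hcop
    have hx : (p : ℕ) ^ k • (a • x + b • y) = x := by
      have : (((p : ℕ) : ℤ) ^ k) • (a • x + b • y) = x := by
        rw [smul_add, smul_comm _ b y, hy', smul_smul, smul_smul, ← add_smul,
          mul_comm _ a, hab, one_smul]
      rw [← natCast_zsmul]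
      exact_mod_cast this
    have h4 : (k : ℕ∞) ≤ pHeight x p :=
      le_iSup₂_of_le (f := fun (n : ℕ) (_ : ∃ y : T, (p : ℕ) ^ n • y = x) => (n : ℕ∞))
        k ⟨_, hx⟩ le_rfl
    push_cast
    rw [add_comm]
    gcongr
  have key2 : ∀ p : Nat.Primes, pHeight x p ≤ pHeight (m • x) p := by
    intro p
    refine iSup₂_le fun n ⟨y, hy⟩ => ?_
    exact le_iSup₂_of_le
      (f := fun (n : ℕ) (_ : ∃ y : T, (p : ℕ) ^ n • y = m • x) => (n : ℕ∞))
      n ⟨m • y, by rw [smul_comm, hy]⟩ le_rfl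
  refine GroupType.mk_eq_mk.2 (Characteristic.equivalent_iff.2 ⟨⟨?_, ?_⟩, .of_le key2⟩)
  · have hfin : {p : Nat.Primes | (p : ℕ) ∈ m.natAbs.primeFactors}.Finite :=
      (Finset.finite_toSet m.natAbs.primeFactors).preimage Nat.Primes.coe_nat_injective.injOn
    refine hfin.subset fun p hp => ?_
    by_contra hc
    have hnd : ¬ (p : ℕ) ∣ m.natAbs := by
      intro hd
      exact hc (Nat.mem_primeFactors.2 ⟨p.2, hd, Int.natAbs_ne_zero.2 hm⟩)
    apply hp
    have := key p
    rw [padicValInt, padicValNat.eq_zero_of_not_dvd hnd] at this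
    simpa using this
  · intro p hp ht
    have h1 := key p
    rw [ht, top_le_iff] at h1
    rcases ENat.add_eq_top.1 h1 with h1 | h1
    · exact hp (h1 ▸ le_top)
    · exact ENat.natCast_ne_top _ h1

theorem IsRankOne.type_eq {T : Type u} [AddCommGroup T] (hT : IsRankOne T) (x : T)
    (hx : x ≠ 0) : elementType x = hT.type := by
  have := hT.torsionFree
  set y := hT.exists_ne_zero.choose with hy
  have hy0 : y ≠ 0 := hT.exists_ne_zero.choose_spec
  have hdep : ¬ LinearIndependent ℤ ![x, y] := by
    intro h
    have h1 := h.cardinal_lift_le_rank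
    rw [hT.rank_eq_one] at h1
    simp at h1
  rw [LinearIndependent.pair_iff] at hdep
  push Not at hdep
  obtain ⟨s, t, hst, h0⟩ := hdep
  have hs : s ≠ 0 := by
    rintro rfl
    have ht : t ≠ 0 := h0 rfl
    rw [zero_smul, zero_add] at hst
    exact hy0 ((smul_eq_zero.1 hst).resolve_left ht)
  have ht : t ≠ 0 := by
    rintro rfl
    rw [zero_smul, add_zero] at hst
    exact hx ((smul_eq_zero.1 hst).resolve_left hs)
  have h2 : s • x = (-t) • y := by rw [neg_smul]; exact eq_neg_of_add_eq_zero_left hst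
  calc elementType x = elementType (s • x) := (elementType_zsmul x s hs).symm
    _ = elementType y := by rw [h2, elementType_zsmul y (-t) (neg_ne_zero.2 ht)]

/-! ### Cotorsion theories -/

/-- `Ext(A, B) = 0` for abelian groups `A` and `B`. -/
def ExtVanishes (A B : ModuleCat.{u} ℤ) : Prop :=
  Subsingleton (CategoryTheory.Abelian.Ext A B 1)

/-- `𝒜^⊥`, the class of all `X` with `Ext(A, X) = 0` for all `A ∈ 𝒜`. -/
def rightPerp (𝒜 : Set (ModuleCat.{u} ℤ)) : Set (ModuleCat.{u} ℤ) :=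
  {X | ∀ A ∈ 𝒜, ExtVanishes A X}

/-- `^⊥ℬ`, the class of all `Y` with `Ext(Y, X) = 0` for all `X ∈ ℬ`. -/
def leftPerp (ℬ : Set (ModuleCat.{u} ℤ)) : Set (ModuleCat.{u} ℤ) :=
  {Y | ∀ X ∈ ℬ, ExtVanishes Y X}

/-- A cotorsion theory `(ℱ, 𝒞)`: a pair of classes of abelian groups, each of which is maximal
with `Ext(F, C) = 0` for all `F ∈ ℱ`, `C ∈ 𝒞`, that is, `ℱ = ^⊥𝒞` and `𝒞 = ℱ^⊥`. -/
@[ext]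
structure CotorsionTheory : Type (u + 1) where
  torsionFreeClass : Set (ModuleCat.{u} ℤ)
  cotorsionClass : Set (ModuleCat.{u} ℤ)
  torsionFreeClass_eq : torsionFreeClass = leftPerp cotorsionClass
  cotorsionClass_eq : cotorsionClass = rightPerp torsionFreeClass

namespace CotorsionTheory

/-- Cotorsion theories are ordered by inclusion of the cotorsion classes. -/
instance : PartialOrder CotorsionTheory.{u} where
  le P Q := P.cotorsionClass ⊆ Q.cotorsionClass
  le_refl _ := subset_rfl
  le_trans _ _ _ h k := Set.Subset.trans h k
  le_antisymm P Q h k := by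
    have hC : P.cotorsionClass = Q.cotorsionClass := Set.Subset.antisymm h k
    exact CotorsionTheory.ext
      (by rw [P.torsionFreeClass_eq, Q.torsionFreeClass_eq, hC]) hC

/-- The cotorsion theory `(^⊥(𝒜^⊥), 𝒜^⊥)` cogenerated by a class `𝒜`. -/
def cogeneratedBy (𝒜 : Set (ModuleCat.{u} ℤ)) : CotorsionTheory.{u} where
  torsionFreeClass := leftPerp (rightPerp 𝒜)
  cotorsionClass := rightPerp 𝒜
  torsionFreeClass_eq := rfl
  cotorsionClass_eq := Set.Subset.antisymm (fun X hX _ hY => hY X hX)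
    (fun _ hX A hA => hX A fun _ hY => hY A hA)

/-- The cotorsion theory `(^⊥(T^⊥), T^⊥)` cogenerated by a single group `T`. -/
def cogeneratedByGroup (T : Type u) [AddCommGroup T] : CotorsionTheory.{u} :=
  cogeneratedBy {ModuleCat.of ℤ T}

/-- A rational cotorsion theory is one that is cogenerated by a rank-1 group. -/
def IsRational (P : CotorsionTheory.{u}) : Prop :=
  ∃ (T : Type u) (_ : AddCommGroup T), IsRankOne T ∧ P = cogeneratedByGroup T

end CotorsionTheory

/-- The rational cotorsion theories, with the order inherited from `CotorsionTheory`. -/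
abbrev RationalCotorsionTheory : Type (u + 1) :=
  {P : CotorsionTheory.{u} // P.IsRational}

/-!
A rank-1 group `T` is the direct limit of a sequence `ℤ → ℤ → ℤ → ⋯` of multiplications by numbers
`k n`, determined by the characteristic of a nonzero element, and `Ext(T, X)` is `lim¹` of the
inverse system `X ← X ← X ← ⋯` of multiplications by the `k n`.

If `t(S) ≤ t(T)`, then `S` embeds into `T`, and `Ext(T, X) = 0` implies `Ext(S, X) = 0` because
`Ext` is right exact for abelian groups.

If `t(S) ≰ t(T)`, let `χ` and `ψ` be characteristics of `S` and `T`. The pairs `(p, c)` with `ψ p`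
finite and `ψ p + 2 * c + 1 ≤ χ p` form an infinite set `I`. In the product `M` of the groups
`ℤ / p ^ (ψ p + 2 * c + 1)` over `(p, c) ∈ I`, the element with entries `p ^ (ψ p + c)` has infinite
order, so some `φ : M → ℚ` maps it to `1`. Then `X = ker φ` separates `S` and `T`: as `lim¹`
vanishes on the product `M` of finite groups, it vanishes on `X` if and only if all compatible
sequences in `ℚ` lift to `M`. They do for `T`, because they can be lifted to sequences starting at
an element divisible by the `p ^ ψ p`. They do not for `S`, because a compatible sequence in `M`
starts at an element divisible by all the `p ^ (ψ p + 2 * c + 1)`, which is `0`.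
-/

open CategoryTheory

/-! ### Vanishing of Ext via divisible groups -/

theorem subsingleton_ext_one_iff {C : Type*} [Category* C] [Abelian C] [HasExt C]
    {E : ShortComplex C} (hE : E.ShortExact) [Injective E.X₂] (T : C) :
    Subsingleton (Abelian.Ext T E.X₁ 1) ↔ ∀ f : T ⟶ E.X₃, ∃ g : T ⟶ E.X₂, g ≫ E.g = f := by
  constructor
  · intro _ f
    obtain ⟨e, he⟩ := Abelian.Ext.covariant_sequence_exact₃ T hE (Abelian.Ext.mk₀ f)
      (zero_add 1) (Subsingleton.elim _ _)
    obtain ⟨g, rfl⟩ := (Abelian.Ext.mk₀_bijective _ _).2 e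
    rw [Abelian.Ext.mk₀_comp_mk₀] at he
    exact ⟨g, (Abelian.Ext.mk₀_bijective _ _).1 he⟩
  · intro h
    refine subsingleton_of_forall_eq 0 fun e => ?_
    obtain ⟨e, rfl⟩ := Abelian.Ext.covariant_sequence_exact₁ T hE e
      (Abelian.Ext.eq_zero_of_injective _) (zero_add 1)
    obtain ⟨f, rfl⟩ := (Abelian.Ext.mk₀_bijective _ _).2 e
    obtain ⟨g, rfl⟩ := h f
    rw [← Abelian.Ext.mk₀_comp_mk₀, Abelian.Ext.comp_assoc_of_second_deg_zero,
      hE.comp_extClass, Abelian.Ext.comp_zero]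

theorem extVanishes_iff_forall_exists_lift {T X D Q : Type u} [AddCommGroup T] [AddCommGroup X]
    [AddCommGroup D] [AddCommGroup Q] [DivisibleBy D ℤ] {i : X →+ D} {q : D →+ Q}
    (hi : Function.Injective i) (hiq : Function.Exact i q) (hq : Function.Surjective q) :
    ExtVanishes (ModuleCat.of ℤ T) (ModuleCat.of ℤ X) ↔
      ∀ f : T →+ Q, ∃ g : T →+ D, q.comp g = f := by
  let E : ShortComplex (ModuleCat.{u} ℤ) :=
    ShortComplex.mk (ModuleCat.ofHom i.toIntLinearMap) (ModuleCat.ofHom q.toIntLinearMap)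
      (ModuleCat.hom_ext (LinearMap.ext hiq.apply_apply_eq_zero))
  have hE : E.ShortExact :=
    { exact := (ShortComplex.ShortExact.moduleCat_exact_iff_function_exact E).2 hiq
      mono_f := (ModuleCat.mono_iff_injective _).2 hi
      epi_g := (ModuleCat.epi_iff_surjective _).2 hq }
  have : Module.Injective ℤ D := (Module.Baer.of_divisible D).injective
  have : Injective E.X₂ := Module.injective_object_of_injective_module ℤ D
  refine (subsingleton_ext_one_iff hE (ModuleCat.of ℤ T)).trans ⟨fun h f => ?_, fun h f => ?_⟩
  · obtain ⟨g, hg⟩ := h (ModuleCat.ofHom f.toIntLinearMap)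
    exact ⟨g.hom.toAddMonoidHom, AddMonoidHom.ext fun t =>
      LinearMap.congr_fun (congrArg ModuleCat.Hom.hom hg) t⟩
  · obtain ⟨g, hg⟩ := h f.hom.toAddMonoidHom
    exact ⟨ModuleCat.ofHom g.toIntLinearMap,
      ModuleCat.hom_ext (LinearMap.ext fun t => DFunLike.congr_fun hg t)⟩

theorem exists_exact_divisible (X : Type u) [AddCommGroup X] :
    ∃ (D Q : Type u) (_ : AddCommGroup D) (_ : AddCommGroup Q) (_ : DivisibleBy D ℤ)
      (_ : DivisibleBy Q ℤ) (i : X →+ D) (q : D →+ Q),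
      Function.Injective i ∧ Function.Exact i q ∧ Function.Surjective q := by
  let i : X →+ CharacterModule X → AddCircle (1 : ℚ) := AddMonoidHom.mk' (fun x χ => χ x)
    fun x y => funext fun χ => map_add χ x y
  have hi : Function.Injective i := (injective_iff_map_eq_zero i).2 fun x hx =>
    CharacterModule.eq_zero_of_character_apply fun χ => congr_fun hx χ
  have hq := QuotientAddGroup.mk'_surjective i.range
  exact ⟨_, _, _, _, inferInstance, hq.divisibleBy _ fun x n => map_zsmul _ n x, i, _,
    hi, fun x => QuotientAddGroup.eq_zero_iff x, hq⟩

theorem ExtVanishes.of_injective {S T : Type u} {X : ModuleCat.{u} ℤ} [AddCommGroup S]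
    [AddCommGroup T] {j : S →+ T} (hj : Function.Injective j)
    (h : ExtVanishes (ModuleCat.of ℤ T) X) : ExtVanishes (ModuleCat.of ℤ S) X := by
  obtain @⟨X, _, inst⟩ := X
  obtain rfl : inst = AddCommGroup.toIntModule X := Subsingleton.elim _ _
  obtain ⟨D, Q, _, _, _, _, i, q, hi, hiq, hq⟩ := exists_exact_divisible X
  rw [extVanishes_iff_forall_exists_lift hi hiq hq] at h ⊢
  intro f
  obtain ⟨f', rfl⟩ := (Module.Baer.of_divisible Q).extension_property_addMonoidHom j hj f
  obtain ⟨g, rfl⟩ := h f'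
  exact ⟨g.comp j, rfl⟩

/-! ### Limits of sequences of multiplications -/

/-- The elements of the limit of the inverse system `A ← A ← A ← ⋯` of multiplications by
`k 0, k 1, k 2, …`. -/
def IsCompatible {A : Type*} [AddCommGroup A] (k : ℕ → ℕ) (y : ℕ → A) : Prop :=
  ∀ n, k n • y (n + 1) = y n

/-- The vanishing of `lim¹` of the inverse system `A ← A ← A ← ⋯` of multiplications by
`k 0, k 1, k 2, …`; here `lim¹` is the cokernel of the map `(b n) ↦ (b n - k n • b (n + 1))` on
the product of the terms. -/
def Lim1Vanishes (k : ℕ → ℕ) (A : Type*) [AddCommGroup A] : Prop :=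
  ∀ a : ℕ → A, ∃ b : ℕ → A, ∀ n, b n - k n • b (n + 1) = a n

section Sequences

variable {A B M T X : Type*} [AddCommGroup A] [AddCommGroup B] [AddCommGroup M] [AddCommGroup T]
  [AddCommGroup X] {k : ℕ → ℕ}

theorem IsCompatible.map {y : ℕ → A} (hy : IsCompatible k y) (f : A →+ B) :
    IsCompatible k fun n => f (y n) := fun n => by
  rw [← map_nsmul, hy n]

theorem IsCompatible.prod_smul {y : ℕ → A} (hy : IsCompatible k y) {m n : ℕ} (h : m ≤ n) :
    (∏ i ∈ Finset.Ico m n, k i) • y n = y m := by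
  induction n, h using Nat.le_induction with
  | base => simp
  | succ n h ih => rw [Finset.prod_Ico_succ_top h, mul_smul, hy, ih]

theorem IsCompatible.exists_zsmul_eq {y : ℕ → A} (hy : IsCompatible k y) {m n : ℕ} (h : m ≤ n)
    (c : ℤ) : ∃ d : ℤ, d • y n = c • y m :=
  ⟨c * (∏ i ∈ Finset.Ico m n, k i : ℕ), by rw [mul_smul, natCast_zsmul, hy.prod_smul h]⟩

theorem IsCompatible.zsmul_eq_zsmul [IsAddTorsionFree T] {y : ℕ → T} (hy : IsCompatible k y)
    (hy0 : ∀ n, y n ≠ 0) {a : ℕ → A} (ha : IsCompatible k a) {m n : ℕ} {c d : ℤ}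
    (h : c • y m = d • y n) : c • a m = d • a n := by
  wlog hmn : m ≤ n generalizing m n c d
  · exact (this h.symm (le_of_not_ge hmn)).symm
  rw [← hy.prod_smul hmn, ← natCast_zsmul, smul_smul] at h
  rw [← ha.prod_smul hmn, ← natCast_zsmul, smul_smul, smul_left_injective ℤ (hy0 n) h]

/-- A torsion-free group generated by a compatible sequence is a direct limit of infinite cyclic
groups, so the homomorphisms out of it are the compatible sequences in the target. -/
theorem IsCompatible.exists_hom [IsAddTorsionFree T] {y : ℕ → T} (hy : IsCompatible k y)
    (hy0 : ∀ n, y n ≠ 0) (hgen : ∀ t, ∃ (n : ℕ) (c : ℤ), t = c • y n) {a : ℕ → A}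
    (ha : IsCompatible k a) : ∃ f : T →+ A, ∀ n, f (y n) = a n := by
  choose N c hc using hgen
  have key : ∀ {t : T} {n : ℕ} {d : ℤ}, t = d • y n → c t • a (N t) = d • a n := fun h =>
    hy.zsmul_eq_zsmul hy0 ha ((hc _).symm.trans h)
  refine ⟨AddMonoidHom.mk' (fun t => c t • a (N t)) fun s t => ?_, fun n => ?_⟩
  · obtain ⟨d, hs⟩ := hy.exists_zsmul_eq (le_max_left (N s) (N t)) (c s)
    obtain ⟨e, ht⟩ := hy.exists_zsmul_eq (le_max_right (N s) (N t)) (c t)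
    rw [← hc] at hs ht
    rw [key hs.symm, key ht.symm, ← add_smul]
    exact key (by rw [add_smul, hs, ht])
  · simpa using key (one_zsmul (y n)).symm

theorem IsCompatible.exists_injective [IsAddTorsionFree T] [IsAddTorsionFree M] {y : ℕ → T}
    (hy : IsCompatible k y) (hy0 : ∀ n, y n ≠ 0) (hgen : ∀ t, ∃ (n : ℕ) (c : ℤ), t = c • y n)
    {z : ℕ → M} (hz : IsCompatible k z) (hz0 : ∀ n, z n ≠ 0) :
    ∃ j : T →+ M, Function.Injective j := by
  obtain ⟨j, hj⟩ := hy.exists_hom hy0 hgen hz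
  refine ⟨j, (injective_iff_map_eq_zero j).2 fun t ht => ?_⟩
  obtain ⟨n, c, rfl⟩ := hgen t
  rw [map_zsmul, hj, smul_eq_zero_iff_left (hz0 n)] at ht
  rw [ht, zero_smul]

theorem Lim1Vanishes.exists_lift {i : X →+ M} {q : M →+ B} (hX : Lim1Vanishes k X)
    (hiq : Function.Exact i q) (hq : Function.Surjective q) {y : ℕ → B} (hy : IsCompatible k y) :
    ∃ z : ℕ → M, IsCompatible k z ∧ ∀ n, q (z n) = y n := by
  choose z hz using fun n => hq (y n)
  have hker : ∀ n, ∃ x, i x = z n - k n • z (n + 1) := fun n =>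
    (hiq _).1 (by rw [map_sub, map_nsmul, hz, hz, hy, sub_self])
  choose a ha using hker
  obtain ⟨b, hb⟩ := hX a
  refine ⟨fun n => z n - i (b n), fun n => ?_, fun n => ?_⟩
  · have h := ha n
    rw [← hb n, map_sub, map_nsmul, sub_eq_sub_iff_add_eq_add] at h
    rw [smul_sub, sub_eq_sub_iff_add_eq_add, add_comm, ← h]
  · rw [map_sub, hz, hiq.apply_apply_eq_zero, sub_zero]

theorem Lim1Vanishes.of_exists_lift {i : X →+ M} {q : M →+ B} (hM : Lim1Vanishes k M)
    (hi : Function.Injective i) (hiq : Function.Exact i q)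
    (hlift : ∀ y : ℕ → B, IsCompatible k y → ∃ z : ℕ → M, IsCompatible k z ∧ ∀ n, q (z n) = y n) :
    Lim1Vanishes k X := by
  intro a
  obtain ⟨b, hb⟩ := hM fun n => i (a n)
  have hqb : IsCompatible k fun n => q (b n) := fun n => by
    rw [← map_nsmul, eq_comm, ← sub_eq_zero, ← map_sub, hb, hiq.apply_apply_eq_zero]
  obtain ⟨z, hz, hzb⟩ := hlift _ hqb
  have hker : ∀ n, ∃ x, i x = b n - z n := fun n =>
    (hiq _).1 (by rw [map_sub, hzb, sub_self])
  choose c hc using hker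
  refine ⟨c, fun n => hi ?_⟩
  rw [map_sub, map_nsmul, hc, hc, smul_sub, hz, sub_sub_sub_cancel_right, hb]

theorem lim1Vanishes_of_surjective (h : ∀ n, Function.Surjective fun x : A => k n • x) :
    Lim1Vanishes k A := fun a => by
  choose f hf using h
  exact ⟨fun n => Nat.rec 0 (fun n x => f n (x - a n)) n, fun n =>
    sub_eq_of_eq_add' (sub_eq_iff_eq_add.1 (hf n _).symm)⟩

theorem lim1Vanishes_of_finite [Finite A] : Lim1Vanishes k A := fun a => by
  -- The solutions are the points of the limit of the finite sets `A` along `x ↦ a n + k n • x`.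
  let F : ℕᵒᵖ ⥤ Type _ := Functor.ofOpSequence (X := fun _ => A) fun n => ↾fun x => a n + k n • x
  have (j : ℕᵒᵖ) : Finite (F.obj j) := ‹Finite A›
  have (j : ℕᵒᵖ) : Nonempty (F.obj j) := ⟨(0 : A)⟩
  obtain ⟨b, hb⟩ := nonempty_sections_of_finite_inverse_system F
  refine ⟨fun n => b (.op n), fun n => sub_eq_of_eq_add ?_⟩
  have h := hb (homOfLE n.le_succ).op
  rw [Functor.ofOpSequence_map_homOfLE_succ] at h
  exact h.symm

theorem Lim1Vanishes.pi {ι : Type*} {A : ι → Type*} [∀ i, AddCommGroup (A i)]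
    (h : ∀ i, Lim1Vanishes k (A i)) : Lim1Vanishes k (∀ i, A i) := fun a => by
  choose b hb using fun i => h i fun n => a n i
  exact ⟨fun n i => b i n, fun n => funext fun i => hb i n⟩

theorem Lim1Vanishes.congr (e : A ≃+ B) (h : Lim1Vanishes k A) : Lim1Vanishes k B := fun a => by
  obtain ⟨b, hb⟩ := h fun n => e.symm (a n)
  exact ⟨fun n => e (b n), fun n => by rw [← map_nsmul, ← map_sub, hb, e.apply_symm_apply]⟩

end Sequences

theorem IsCompatible.extVanishes_iff {T X : Type u} [AddCommGroup T] [AddCommGroup X]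
    [IsAddTorsionFree T] {k : ℕ → ℕ} {y : ℕ → T} (hy : IsCompatible k y) (hy0 : ∀ n, y n ≠ 0)
    (hgen : ∀ t, ∃ (n : ℕ) (c : ℤ), t = c • y n) :
    ExtVanishes (ModuleCat.of ℤ T) (ModuleCat.of ℤ X) ↔ Lim1Vanishes k X := by
  have hk : ∀ n, k n ≠ 0 := fun n h => hy0 n (by rw [← hy n, h, zero_smul])
  obtain ⟨D, Q, _, _, _, _, i, q, hi, hiq, hq⟩ := exists_exact_divisible X
  rw [extVanishes_iff_forall_exists_lift hi hiq hq]
  constructor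
  · intro h
    have hD : Lim1Vanishes k D := lim1Vanishes_of_surjective fun n x =>
      ⟨DivisibleBy.div x (k n : ℤ), by
        simpa using DivisibleBy.div_cancel x (Int.natCast_ne_zero.2 (hk n))⟩
    refine hD.of_exists_lift hi hiq fun a ha => ?_
    obtain ⟨f, hf⟩ := hy.exists_hom hy0 hgen ha
    obtain ⟨g, rfl⟩ := h f
    exact ⟨fun n => g (y n), hy.map g, hf⟩
  · intro h f
    obtain ⟨a, ha, hqa⟩ := h.exists_lift hiq hq (hy.map f)
    obtain ⟨g, hg⟩ := hy.exists_hom hy0 hgen ha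
    refine ⟨g, AddMonoidHom.ext fun t => ?_⟩
    obtain ⟨n, c, rfl⟩ := hgen t
    rw [map_zsmul, map_zsmul, AddMonoidHom.comp_apply, hg, hqa]

/-! ### Denominators admitted by a characteristic -/

namespace Characteristic

variable {χ ψ : Characteristic}

/-- `a` is a denominator admitted by `χ`: it is nonzero and its `p`-adic valuation is at most `χ p`
for all primes `p`. These are the denominators of the rational numbers in the group of
characteristic `χ`. -/
def Admits (χ : Characteristic) (a : ℕ) : Prop :=
  a ≠ 0 ∧ ∀ (p : Nat.Primes) (e : ℕ), (p : ℕ) ^ e ∣ a → (e : ℕ∞) ≤ χ p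

theorem Admits.mono {a : ℕ} (h : χ.Admits a) (hχ : χ ≤ ψ) : ψ.Admits a :=
  ⟨h.1, fun p e he => (h.2 p e he).trans (hχ p)⟩

theorem Admits.of_dvd {a b : ℕ} (h : χ.Admits b) (hab : a ∣ b) : χ.Admits a :=
  ⟨ne_zero_of_dvd_ne_zero h.1 hab, fun p e he => h.2 p e (he.trans hab)⟩

theorem Admits.lcm {a b : ℕ} (ha : χ.Admits a) (hb : χ.Admits b) : χ.Admits (a.lcm b) := by
  refine ⟨Nat.lcm_ne_zero ha.1 hb.1, fun p e h => ?_⟩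
  rw [p.2.pow_dvd_iff_le_factorization (Nat.lcm_ne_zero ha.1 hb.1),
    Nat.factorization_lcm ha.1 hb.1, Finsupp.sup_apply, le_sup_iff,
    ← p.2.pow_dvd_iff_le_factorization ha.1, ← p.2.pow_dvd_iff_le_factorization hb.1] at h
  exact h.elim (ha.2 p e) (hb.2 p e)

theorem admits_prime_pow {p : Nat.Primes} {e : ℕ} : χ.Admits ((p : ℕ) ^ e) ↔ (e : ℕ∞) ≤ χ p := by
  refine ⟨fun h => h.2 p e dvd_rfl, fun h => ⟨pow_ne_zero _ p.2.ne_zero, fun q f hq => ?_⟩⟩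
  rcases Nat.eq_zero_or_pos f with rfl | hf
  · simp
  obtain rfl : q = p := Subtype.ext <| (Nat.prime_dvd_prime_iff_eq q.2 p.2).1 <|
    q.2.dvd_of_dvd_pow ((dvd_pow_self _ hf.ne').trans hq)
  exact (Nat.cast_le.2 ((Nat.pow_dvd_pow_iff_le_right q.2.one_lt).1 hq)).trans h

theorem admits_one : χ.Admits 1 := admits_prime_pow (p := ⟨2, Nat.prime_two⟩) (e := 0).2 zero_le

open Classical in
/-- The least common multiple of the denominators up to `n` that `χ` admits. -/
noncomputable def denom (χ : Characteristic) (n : ℕ) : ℕ :=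
  ((Finset.Icc 1 n).filter χ.Admits).lcm id

theorem admits_denom (χ : Characteristic) (n : ℕ) : χ.Admits (χ.denom n) := by
  classical
  suffices h : ∀ s : Finset ℕ, (∀ a ∈ s, χ.Admits a) → χ.Admits (s.lcm id) from
    h _ fun a ha => (Finset.mem_filter.1 ha).2
  intro s hs
  induction s using Finset.induction_on with
  | empty => exact admits_one
  | insert a s _ ih =>
    rw [Finset.forall_mem_insert] at hs
    rw [Finset.lcm_insert]
    exact hs.1.lcm (ih hs.2)

theorem denom_ne_zero (χ : Characteristic) (n : ℕ) : χ.denom n ≠ 0 := (χ.admits_denom n).1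

theorem denom_zero (χ : Characteristic) : χ.denom 0 = 1 := by simp [denom]

theorem Admits.dvd_denom {a : ℕ} (h : χ.Admits a) : a ∣ χ.denom a := by
  classical
  exact Finset.dvd_lcm (f := id)
    (Finset.mem_filter.2 ⟨Finset.mem_Icc.2 ⟨Nat.pos_of_ne_zero h.1, le_rfl⟩, h⟩)

theorem denom_dvd_denom_succ (χ : Characteristic) (n : ℕ) : χ.denom n ∣ χ.denom (n + 1) := by
  classical
  exact Finset.lcm_mono (Finset.filter_subset_filter _ (Finset.Icc_subset_Icc_right n.le_succ))

/-- The quotients of consecutive denominators: the group of characteristic `χ` is the direct limit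
of the sequence `ℤ → ℤ → ℤ → ⋯` of multiplications by these numbers. -/
noncomputable def ratio (χ : Characteristic) (n : ℕ) : ℕ := χ.denom (n + 1) / χ.denom n

theorem denom_mul_ratio (χ : Characteristic) (n : ℕ) :
    χ.denom n * χ.ratio n = χ.denom (n + 1) :=
  Nat.mul_div_cancel' (χ.denom_dvd_denom_succ n)

theorem denom_smul_of_isCompatible {A : Type*} [AddCommGroup A] {y : ℕ → A}
    (hy : IsCompatible χ.ratio y) (n : ℕ) : χ.denom n • y n = y 0 := by
  induction n with
  | zero => rw [denom_zero, one_smul]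
  | succ n ih => rw [← denom_mul_ratio, mul_smul, hy, ih]

end Characteristic

section Heights

variable {T : Type*} [AddCommGroup T] {x : T}

theorem natCast_le_pHeight_iff {p : Nat.Primes} {n : ℕ} :
    (n : ℕ∞) ≤ pHeight x p ↔ ∃ y : T, (p : ℕ) ^ n • y = x := by
  refine ⟨fun h => ?_, fun h => le_iSup₂_of_le (f := fun (n : ℕ) _ => (n : ℕ∞)) n h le_rfl⟩
  by_contra hn
  have hlt : ∀ m, (∃ y : T, (p : ℕ) ^ m • y = x) → m < n := by
    rintro m ⟨y, rfl⟩
    by_contra! hm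
    exact hn ⟨(p : ℕ) ^ (m - n) • y, by rw [smul_smul, ← pow_add, Nat.add_sub_cancel' hm]⟩
  have h0 : 0 < n := hlt 0 ⟨x, by simp⟩
  have hle : pHeight x p ≤ (n - 1 : ℕ) := iSup₂_le fun m hm =>
    Nat.cast_le.2 (Nat.le_sub_one_of_lt (hlt m hm))
  exact (Nat.sub_lt h0 one_pos).not_ge (Nat.cast_le.1 (h.trans hle))

theorem exists_mul_smul_eq_of_coprime {a b : ℕ} (hab : a.Coprime b) (ha : ∃ y : T, a • y = x)
    (hb : ∃ y : T, b • y = x) : ∃ y : T, (a * b) • y = x := by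
  obtain ⟨y, hy⟩ := ha
  obtain ⟨z, hz⟩ := hb
  obtain ⟨u, v, huv⟩ := Nat.isCoprime_iff_coprime.2 hab
  refine ⟨u • z + v • y, ?_⟩
  calc (a * b) • (u • z + v • y) = u • a • b • z + v • b • a • y := by module
    _ = (u * a + v * b) • x := by rw [hy, hz]; module
    _ = x := by rw [huv, one_smul]

theorem admits_pHeight_iff {a : ℕ} (ha : a ≠ 0) :
    Characteristic.Admits (pHeight x) a ↔ ∃ y : T, a • y = x := by
  constructor
  · induction a using Nat.recOnPosPrimePosCoprime with
    | prime_pow p n hp _ =>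
      exact fun h => natCast_le_pHeight_iff.1 (Characteristic.admits_prime_pow (p := ⟨p, hp⟩).1 h)
    | zero => exact (ha rfl).elim
    | one => exact fun _ => ⟨x, one_smul _ _⟩
    | coprime a b ha hb hab iha ihb =>
      exact fun h => exists_mul_smul_eq_of_coprime hab
        (iha (by positivity) (h.of_dvd (dvd_mul_right a b)))
        (ihb (by positivity) (h.of_dvd (dvd_mul_left b a)))
  · rintro ⟨y, hy⟩
    refine ⟨ha, fun p e ⟨c, hc⟩ => natCast_le_pHeight_iff.2 ⟨c • y, ?_⟩⟩
    rw [smul_smul, ← hc, hy]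

theorem exists_isCompatible_ratio [IsAddTorsionFree T] {χ : Characteristic} (h : χ ≤ pHeight x) :
    ∃ y : ℕ → T, IsCompatible χ.ratio y ∧ y 0 = x := by
  choose y hy using fun n =>
    (admits_pHeight_iff (χ.denom_ne_zero n)).1 ((χ.admits_denom n).mono h)
  refine ⟨y, fun n => nsmul_right_injective (χ.denom_ne_zero n) ?_, ?_⟩
  · change χ.denom n • χ.ratio n • y (n + 1) = χ.denom n • y n
    rw [smul_smul, χ.denom_mul_ratio, hy, hy]
  · rw [← hy 0, χ.denom_zero, one_smul]

theorem IsCompatible.ne_zero {χ : Characteristic} {y : ℕ → T} (hy : IsCompatible χ.ratio y)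
    (h0 : y 0 ≠ 0) (n : ℕ) : y n ≠ 0 := fun h =>
  h0 (by rw [← χ.denom_smul_of_isCompatible hy n, h, smul_zero])

theorem pHeight_add_le_pHeight_smul (p : Nat.Primes) {m e : ℕ} (h : (p : ℕ) ^ e ∣ m) :
    pHeight x p + e ≤ pHeight (m • x) p := by
  obtain ⟨c, rfl⟩ := h
  refine ENat.forall_natCast_le_iff_le.1 fun n hn => natCast_le_pHeight_iff.2 ?_
  rcases le_total n e with hne | hne
  · refine ⟨((p : ℕ) ^ (e - n) * c) • x, ?_⟩
    rw [smul_smul, ← mul_assoc, ← pow_add, Nat.add_sub_cancel' hne]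
  · obtain ⟨d, rfl⟩ := Nat.exists_eq_add_of_le' hne
    rw [Nat.cast_add, ENat.add_le_add_iff_right (ENat.natCast_ne_top e)] at hn
    obtain ⟨y, rfl⟩ := natCast_le_pHeight_iff.1 hn
    exact ⟨c • y, by rw [smul_smul, smul_smul]; congr 1; ring⟩

theorem exists_le_pHeight_smul {χ : Characteristic} (h : χ.AlmostLE (pHeight x)) :
    ∃ m : ℕ, m ≠ 0 ∧ χ ≤ pHeight (m • x) := by
  refine ⟨∏ p ∈ h.1.toFinset, (p : ℕ) ^ (χ p).toNat,
    Finset.prod_ne_zero_iff.2 fun p _ => pow_ne_zero _ p.2.ne_zero, fun p => ?_⟩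
  by_cases hp : χ p ≤ pHeight x p
  · exact (hp.trans le_self_add).trans (pHeight_add_le_pHeight_smul p (e := 0) (by simp))
  · refine le_trans ?_ (pHeight_add_le_pHeight_smul p (Finset.dvd_prod_of_mem
      (fun p : Nat.Primes => (p : ℕ) ^ (χ p).toNat) (h.1.mem_toFinset.2 hp)))
    rw [ENat.natCast_toNat (h.2 p hp)]
    exact le_add_self

end Heights

/-! ### Rank-1 groups -/

section RankOne

variable {S T X : Type u} [AddCommGroup S] [AddCommGroup T] [AddCommGroup X]

theorem IsRankOne.exists_zsmul_eq_and_zsmul_eq (hT : IsRankOne T) {x : T} (hx : x ≠ 0) (t : T) :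
    ∃ (z : T) (a b : ℤ), a ≠ 0 ∧ a • z = x ∧ b • z = t := by
  have := hT.torsionFree
  have hdep : ¬ LinearIndependent ℤ ![t, x] := fun h => by
    simpa [hT.rank_eq_one] using h.cardinal_lift_le_rank
  rw [LinearIndependent.pair_iff] at hdep
  push Not at hdep
  obtain ⟨r, s, hrs, h0⟩ := hdep
  have hr : r ≠ 0 := by
    rintro rfl
    rw [zero_smul, zero_add] at hrs
    exact (smul_eq_zero.1 hrs).elim (h0 rfl) hx
  obtain ⟨g, a, b, hg, hab, rfl, rfl⟩ := Int.exists_gcd_one' (Int.gcd_pos_of_ne_zero_left s hr)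
  obtain ⟨u, v, huv⟩ := Int.isCoprime_iff_gcd_eq_one.2 hab
  have hrel : a • t + b • x = 0 := nsmul_right_injective hg.ne' (by
    change g • (a • t + b • x) = g • (0 : T)
    rw [smul_zero, ← hrs]
    module)
  refine ⟨u • x - v • t, a, -b, left_ne_zero_of_mul hr, ?_, ?_⟩
  · calc a • (u • x - v • t) = (u * a + v * b) • x - v • (a • t + b • x) := by module
      _ = x := by rw [huv, hrel, one_smul, smul_zero, sub_zero]
  · calc -b • (u • x - v • t) = (u * a + v * b) • t - u • (a • t + b • x) := by module
      _ = t := by rw [huv, hrel, one_smul, smul_zero, sub_zero]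

theorem IsRankOne.exists_eq_zsmul (hT : IsRankOne T) {y : ℕ → T}
    (hy : IsCompatible (Characteristic.ratio (pHeight (y 0))) y) (h0 : y 0 ≠ 0) (t : T) :
    ∃ (n : ℕ) (c : ℤ), t = c • y n := by
  have := hT.torsionFree
  obtain ⟨z, a, b, ha, hz, rfl⟩ := hT.exists_zsmul_eq_and_zsmul_eq h0 t
  have hadm : Characteristic.Admits (pHeight (y 0)) a.natAbs :=
    (admits_pHeight_iff (Int.natAbs_ne_zero.2 ha)).2
      ⟨a.sign • z, by rw [← natCast_zsmul, smul_smul, mul_comm, Int.sign_mul_natAbs, hz]⟩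
  obtain ⟨c, hc⟩ := Int.natAbs_dvd.1 (Int.natCast_dvd_natCast.2 hadm.dvd_denom)
  have hzc : z = c • y a.natAbs := zsmul_right_injective ha (by
    change a • z = a • c • y a.natAbs
    rw [hz, smul_smul, ← hc, natCast_zsmul, Characteristic.denom_smul_of_isCompatible hy])
  exact ⟨a.natAbs, b * c, by rw [hzc, smul_smul]⟩

theorem IsRankOne.extVanishes_iff (hT : IsRankOne T) {x : T} (hx : x ≠ 0) :
    ExtVanishes (ModuleCat.of ℤ T) (ModuleCat.of ℤ X) ↔
      Lim1Vanishes (Characteristic.ratio (pHeight x)) X := by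
  have := hT.torsionFree
  obtain ⟨y, hy, rfl⟩ := exists_isCompatible_ratio (le_refl (pHeight x))
  exact hy.extVanishes_iff (hy.ne_zero hx) (hT.exists_eq_zsmul hy hx)

theorem IsRankOne.exists_injective (hS : IsRankOne S) (hT : IsRankOne T)
    (h : hS.type ≤ hT.type) : ∃ j : S →+ T, Function.Injective j := by
  have := hS.torsionFree
  have := hT.torsionFree
  obtain ⟨x, hx⟩ := hS.exists_ne_zero
  obtain ⟨z, hz⟩ := hT.exists_ne_zero
  rw [← hS.type_eq x hx, ← hT.type_eq z hz, elementType, elementType, GroupType.mk_le_mk] at h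
  obtain ⟨m, hm, hle⟩ := exists_le_pHeight_smul h
  obtain ⟨y, hy, rfl⟩ := exists_isCompatible_ratio (le_refl (pHeight x))
  obtain ⟨w, hw, hw0⟩ := exists_isCompatible_ratio hle
  exact hy.exists_injective (hy.ne_zero hx) (hS.exists_eq_zsmul hy hx) hw
    (hw.ne_zero (hw0 ▸ smul_ne_zero hm hz))

end RankOne

section Existence

/-- The group of all rational numbers with denominators admitted by `χ`, in which `1` has
characteristic `χ`. -/
def Characteristic.rationalGroup (χ : Characteristic) : AddSubgroup ℚ where
  carrier := {q | χ.Admits q.den}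
  zero_mem' := χ.admits_one
  add_mem' hq hr := (hq.lcm hr).of_dvd (Rat.add_den_dvd_lcm _ _)
  neg_mem' hq := by rwa [Set.mem_ofPred_eq, Rat.neg_den]

theorem Characteristic.inv_natCast_mem_rationalGroup {χ : Characteristic} {a : ℕ} (ha : a ≠ 0) :
    (a : ℚ)⁻¹ ∈ χ.rationalGroup ↔ χ.Admits a := by
  change χ.Admits (a : ℚ)⁻¹.den ↔ _
  rw [Rat.inv_natCast_den, if_neg ha]

variable {T : Type*} [AddCommGroup T] {f : T →+ ℚ}

theorem isRankOne_of_injective [Nontrivial T] (hf : Function.Injective f) : IsRankOne T := by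
  have : IsAddTorsionFree T := hf.isAddTorsionFree f
  refine ⟨this, le_antisymm ?_ (Cardinal.one_le_iff_pos.2 rank_pos)⟩
  have h := LinearMap.lift_rank_le_of_injective f.toIntLinearMap hf
  rw [← IsFractionRing.rank_right_eq ℤ ℚ ℚ, CommSemiring.rank_self] at h
  simpa using h

theorem pHeight_eq_of_range_eq (hf : Function.Injective f) {χ : Characteristic}
    (hχ : f.range = χ.rationalGroup) {x : T} (hx : f x = 1) : pHeight x = χ := by
  funext p
  refine ENat.eq_of_forall_natCast_le_iff fun n => ?_
  have hpn : (p : ℕ) ^ n ≠ 0 := pow_ne_zero _ p.2.ne_zero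
  rw [natCast_le_pHeight_iff, ← Characteristic.admits_prime_pow,
    ← Characteristic.inv_natCast_mem_rationalGroup hpn, ← hχ, AddMonoidHom.mem_range]
  refine exists_congr fun y => ?_
  rw [← hf.eq_iff, map_nsmul, hx, nsmul_eq_mul, mul_comm,
    mul_eq_one_iff_eq_inv₀ (Nat.cast_ne_zero.2 hpn)]

theorem GroupType.exists_isRankOne (τ : GroupType) :
    ∃ (T : Type u) (_ : AddCommGroup T) (hT : IsRankOne T), hT.type = τ := by
  obtain ⟨χ, rfl⟩ := Quotient.exists_rep τ
  let f : ULift.{u} χ.rationalGroup →+ ℚ :=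
    χ.rationalGroup.subtype.comp AddEquiv.ulift.toAddMonoidHom
  have hf : Function.Injective f := Subtype.val_injective.comp ULift.down_injective
  have hrange : f.range = χ.rationalGroup :=
    SetLike.coe_injective <| (AddEquiv.ulift.surjective.range_comp _).trans Subtype.range_coe
  let x : ULift.{u} χ.rationalGroup := ⟨1, χ.admits_one⟩
  have hx : x ≠ 0 := fun h => one_ne_zero (congrArg f h)
  have : Nontrivial (ULift.{u} χ.rationalGroup) := ⟨x, 0, hx⟩
  have hT := isRankOne_of_injective hf
  refine ⟨_, _, hT, ?_⟩
  rw [← hT.type_eq x hx, elementType, pHeight_eq_of_range_eq hf hrange rfl]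
  rfl

end Existence

/-! ### Separation of characteristics -/

section Separation

theorem finite_setOf_prime_pow_succ_dvd {n : ℕ} (hn : n ≠ 0) :
    {i : Nat.Primes × ℕ | (i.1 : ℕ) ^ (i.2 + 1) ∣ n}.Finite := by
  have hinj : Function.Injective fun i : Nat.Primes × ℕ => (i.1 : ℕ) ^ (i.2 + 1) :=
    Subtype.val_injective.comp Nat.Primes.prodNatEquiv.injective
  exact (n.divisors.finite_toSet.preimage hinj.injOn).subset fun i hi =>
    Nat.mem_divisors.2 ⟨hi, hn⟩

theorem le_pHeight_padicInt_pow {p : Nat.Primes} [Fact (p : ℕ).Prime] {ψ : Characteristic} {e : ℕ}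
    (h : ψ p ≤ e) : ψ ≤ pHeight (((p : ℕ) : ℤ_[p]) ^ e) := fun q => by
  rcases eq_or_ne q p with rfl | hqp
  · exact h.trans (natCast_le_pHeight_iff.2 ⟨1, by simp⟩)
  · refine ENat.forall_natCast_le_iff_le.1 fun n _ => natCast_le_pHeight_iff.2 ?_
    have hq : IsUnit ((q : ℕ) : ℤ_[p]) := PadicInt.isUnit_iff.2 <|
      PadicInt.norm_natCast_eq_one_iff.2 <|
        (Nat.coprime_primes p.2 q.2).2 fun h => hqp (Subtype.ext h.symm)
    obtain ⟨c, hc⟩ := (hq.pow n).dvd (a := ((p : ℕ) : ℤ_[p]) ^ e)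
    exact ⟨c, by rw [hc, nsmul_eq_mul, Nat.cast_pow]⟩

-- The extra factor `d` makes both sides vanish when `p ^ (c + 1) ∣ d`; otherwise `p ^ c / d` is
-- defined in `R`.
theorem exists_mul_mul_prime_pow_mul_eq {R : Type*} [CommRing R] {p : ℕ} (hp : p.Prime) {s c : ℕ}
    (hp0 : (p : R) ^ (s + 2 * c + 1) = 0) {d : ℕ} (hd : d ≠ 0) :
    ∃ u : R, d * (d * (p ^ s * u)) = d * p ^ (s + c) := by
  obtain ⟨v, m, hm, rfl⟩ := Nat.exists_eq_pow_mul_and_not_dvd hd p hp.ne_one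
  push_cast
  rcases le_or_gt v c with hv | hv
  · obtain ⟨t, rfl⟩ := Nat.exists_eq_add_of_le hv
    obtain ⟨a, b, hab⟩ :=
      ((hp.coprime_iff_not_dvd.2 hm).symm.pow_right (s + 2 * (v + t) + 1)).cast (R := R)
    rw [Nat.cast_pow, hp0, mul_zero, add_zero] at hab
    exact ⟨p ^ t * a, by linear_combination ((p : R) ^ (v + v + s + t) * m) * hab⟩
  · obtain ⟨t, rfl⟩ := Nat.exists_eq_add_of_lt hv
    exact ⟨0, by linear_combination (-(p : R) ^ t * m) * hp0⟩

/-- The product of the cyclic groups of order `p ^ (s p + 2 * c + 1)` over all `(p, c) ∈ I`. -/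
abbrev CyclicProduct (I : Set (Nat.Primes × ℕ)) (s : Nat.Primes → ℕ) : Type :=
  ∀ i : I, ZMod ((i.1.1 : ℕ) ^ (s i.1.1 + 2 * i.1.2 + 1))

namespace CyclicProduct

variable {I : Set (Nat.Primes × ℕ)} {s : Nat.Primes → ℕ} {χ ψ : Characteristic}

/-- The element with entries `p ^ (s p + c)`. It has infinite order if `I` is infinite, and maps
`CyclicProduct I s →+ ℚ` are normalized to take the value `1` on it. -/
def base (I : Set (Nat.Primes × ℕ)) (s : Nat.Primes → ℕ) : CyclicProduct I s :=
  fun i => (i.1.1 : ZMod _) ^ (s i.1.1 + i.1.2)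

/-- The element with entries `p ^ s p`. Its multiples are the initial terms of compatible sequences
for characteristics bounded by `s`. -/
def root (I : Set (Nat.Primes × ℕ)) (s : Nat.Primes → ℕ) : CyclicProduct I s :=
  fun i => (i.1.1 : ZMod _) ^ s i.1.1

theorem exists_map_base_eq_one (hI : I.Infinite) :
    ∃ φ : CyclicProduct I s →+ ℚ, φ (base I s) = 1 := by
  have hinj : Function.Injective (zmultiplesHom (CyclicProduct I s) (base I s)) := by
    refine (injective_iff_map_eq_zero _).2 fun d hd => ?_
    by_contra hd0
    refine hI ((finite_setOf_prime_pow_succ_dvd (Int.natAbs_ne_zero.2 hd0)).subset fun i hi => ?_)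
    have h : ((d * (i.1 : ℕ) ^ (s i.1 + i.2) : ℤ) :
        ZMod ((i.1 : ℕ) ^ (s i.1 + 2 * i.2 + 1))) = 0 := by
      simpa [base] using congr_fun hd ⟨i, hi⟩
    rw [ZMod.intCast_zmod_eq_zero_iff_dvd,
      show s i.1 + 2 * i.2 + 1 = i.2 + 1 + (s i.1 + i.2) by ring, pow_add, Nat.cast_mul,
      Nat.cast_pow _ (s i.1 + i.2)] at h
    exact Int.natCast_dvd.1 (Int.dvd_of_mul_dvd_mul_right
      (pow_ne_zero _ (Nat.cast_ne_zero.2 i.1.2.ne_zero)) h)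
  obtain ⟨φ, hφ⟩ := (Module.Baer.of_divisible ℚ).extension_property_addMonoidHom _ hinj
    (Int.castAddHom ℚ)
  exact ⟨φ, by simpa using DFunLike.congr_fun hφ 1⟩

theorem exists_map_root_mul_eq {φ : CyclicProduct I s →+ ℚ} (hφ : φ (base I s) = 1) (r : ℚ) :
    ∃ u, φ (root I s * u) = r := by
  choose u hu using fun i : I =>
    exists_mul_mul_prime_pow_mul_eq (R := ZMod ((i.1.1 : ℕ) ^ (s i.1.1 + 2 * i.1.2 + 1))) i.1.1.2
      (by rw [← Nat.cast_pow, ZMod.natCast_self]) r.den_ne_zero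
  have h : r.den • r.den • (root I s * u) = r.den • base I s := funext fun i => by
    simpa [root, base] using hu i
  have hd : (r.den : ℚ) ≠ 0 := Nat.cast_ne_zero.2 r.den_ne_zero
  have hr : φ (root I s * u) = (r.den : ℚ)⁻¹ := by
    have hφh := congrArg φ h
    rw [map_nsmul, map_nsmul, map_nsmul, hφ] at hφh
    simp only [nsmul_eq_mul] at hφh
    exact eq_inv_of_mul_eq_one_right (mul_left_cancel₀ hd hφh)
  refine ⟨r.num • u, ?_⟩
  rw [mul_smul_comm, map_zsmul, hr, zsmul_eq_mul, ← div_eq_mul_inv, Rat.num_div_den]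

theorem exists_isCompatible_root_mul (h : ∀ i ∈ I, ψ i.1 ≤ s i.1) (u : CyclicProduct I s) :
    ∃ z : ℕ → CyclicProduct I s, IsCompatible ψ.ratio z ∧ z 0 = root I s * u := by
  have hz (i : I) : ∃ z : ℕ → ZMod ((i.1.1 : ℕ) ^ (s i.1.1 + 2 * i.1.2 + 1)),
      IsCompatible ψ.ratio z ∧ z 0 = root I s i * u i := by
    have : Fact (i.1.1 : ℕ).Prime := ⟨i.1.1.2⟩
    obtain ⟨y, hy, hy0⟩ := exists_isCompatible_ratio (le_pHeight_padicInt_pow (h i.1 i.2))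
    refine ⟨_, (hy.map (PadicInt.toZModPow _).toAddMonoidHom).map (AddMonoidHom.mulRight (u i)), ?_⟩
    simp [hy0, root]
  choose z hz hz0 using hz
  exact ⟨fun n i => z i n, fun n => funext fun i => hz i n, funext hz0⟩

theorem lim1Vanishes_ratio : Lim1Vanishes ψ.ratio (CyclicProduct I s) :=
  Lim1Vanishes.pi fun i => by
    have : NeZero ((i.1.1 : ℕ) ^ (s i.1.1 + 2 * i.1.2 + 1)) := ⟨pow_ne_zero _ i.1.1.2.ne_zero⟩
    exact lim1Vanishes_of_finite

theorem lim1Vanishes_ker {φ : CyclicProduct I s →+ ℚ} (hφ : φ (base I s) = 1)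
    (h : ∀ i ∈ I, ψ i.1 ≤ s i.1) : Lim1Vanishes ψ.ratio φ.ker := by
  refine lim1Vanishes_ratio.of_exists_lift (q := φ) φ.ker.subtype_injective
    (fun x => by simp) fun y hy => ?_
  obtain ⟨u, hu⟩ := exists_map_root_mul_eq hφ (y 0)
  obtain ⟨z, hz, hz0⟩ := exists_isCompatible_root_mul h u
  refine ⟨z, hz, fun n => nsmul_right_injective (ψ.denom_ne_zero n) ?_⟩
  change ψ.denom n • φ (z n) = ψ.denom n • y n
  rw [Characteristic.denom_smul_of_isCompatible hy, ← hu, ← hz0,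
    Characteristic.denom_smul_of_isCompatible (hz.map φ)]

theorem not_lim1Vanishes_ker {φ : CyclicProduct I s →+ ℚ} (hφ : φ (base I s) = 1)
    (h : ∀ i ∈ I, (s i.1 + 2 * i.2 + 1 : ℕ) ≤ χ i.1) : ¬ Lim1Vanishes χ.ratio φ.ker := by
  intro hker
  obtain ⟨y, hy, hy0⟩ := exists_isCompatible_ratio (x := (1 : ℚ)) (χ := χ) fun p =>
    ENat.forall_natCast_le_iff_le.1 fun n _ => natCast_le_pHeight_iff.2 ⟨((p : ℚ) ^ n)⁻¹, by
      simp [p.2.ne_zero]⟩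
  have hsurj : Function.Surjective φ := fun r => (exists_map_root_mul_eq hφ r).imp' _ fun _ => id
  obtain ⟨z, hz, hzy⟩ := hker.exists_lift (i := φ.ker.subtype) (q := φ) (fun x => by simp) hsurj hy
  have hz0 : z 0 = 0 := funext fun i => by
    obtain ⟨c, hc⟩ := (Characteristic.admits_prime_pow.2 (h i.1 i.2)).dvd_denom
    rw [← Characteristic.denom_smul_of_isCompatible hz, hc, Pi.smul_apply, mul_smul, Pi.zero_apply,
      nsmul_eq_mul, ZMod.natCast_self, zero_mul]
  refine one_ne_zero (α := ℚ) ?_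
  rw [← hy0, ← hzy, hz0, map_zero]

end CyclicProduct

theorem exists_separating_of_not_almostLE {χ ψ : Characteristic} (h : ¬ χ.AlmostLE ψ) :
    ∃ (X : Type) (_ : AddCommGroup X), Lim1Vanishes ψ.ratio X ∧ ¬ Lim1Vanishes χ.ratio X := by
  let I : Set (Nat.Primes × ℕ) := {i | ψ i.1 ≠ ⊤ ∧ ψ i.1 + (2 * i.2 + 1 : ℕ) ≤ χ i.1}
  have hI : I.Infinite := by
    by_cases hinf : {p | ¬ χ p ≤ ψ p}.Infinite
    · refine (hinf.image (f := fun p => (p, 0)) (Prod.mk_left_injective 0).injOn).mono ?_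
      rintro _ ⟨p, hp, rfl⟩
      exact ⟨(not_le.1 hp).ne_top, Order.add_one_le_of_lt (not_le.1 hp)⟩
    · obtain ⟨p, hp, htop⟩ : ∃ p, ¬ χ p ≤ ψ p ∧ χ p = ⊤ := by
        by_contra! hc
        exact h ⟨Set.not_infinite.1 hinf, fun p hp => hc p (not_le.1 hp)⟩
      exact Set.infinite_of_injective_forall_mem (Prod.mk_right_injective p) fun c =>
        ⟨(not_le.1 hp).ne_top, htop ▸ le_top⟩
  obtain ⟨φ, hφ⟩ := CyclicProduct.exists_map_base_eq_one (s := fun p => (ψ p).toNat) hI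
  have hs : ∀ i ∈ I, ((ψ i.1).toNat : ℕ∞) = ψ i.1 := fun i hi => ENat.natCast_toNat hi.1
  exact ⟨φ.ker, inferInstance, CyclicProduct.lim1Vanishes_ker hφ fun i hi => (hs i hi).ge,
    CyclicProduct.not_lim1Vanishes_ker hφ fun i hi => by
      rw [add_assoc, Nat.cast_add, hs i hi]; exact hi.2⟩

end Separation

/-! ### The lattice of rational cotorsion theories -/

namespace CotorsionTheory

theorem cogeneratedByGroup_le_iff {S T : Type u} [AddCommGroup S] [AddCommGroup T]
    (hS : IsRankOne S) (hT : IsRankOne T) :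
    cogeneratedByGroup T ≤ cogeneratedByGroup S ↔ hS.type ≤ hT.type := by
  constructor
  · obtain ⟨x, hx⟩ := hS.exists_ne_zero
    obtain ⟨z, hz⟩ := hT.exists_ne_zero
    rw [← hS.type_eq x hx, ← hT.type_eq z hz, elementType, elementType, GroupType.mk_le_mk]
    contrapose!
    intro hle h
    obtain ⟨X, _, hXT, hXS⟩ := exists_separating_of_not_almostLE hle
    have hmem : ModuleCat.of ℤ (ULift.{u} X) ∈ (cogeneratedByGroup T).cotorsionClass := by
      rintro _ rfl
      exact (hT.extVanishes_iff hz).2 (hXT.congr AddEquiv.ulift.symm)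
    exact hXS (((hS.extVanishes_iff hx).1 (h hmem _ rfl)).congr AddEquiv.ulift)
  · rintro h X hX _ rfl
    obtain ⟨j, hj⟩ := hS.exists_injective hT h
    exact (hX _ rfl).of_injective hj

theorem cogeneratedByGroup_eq {S T : Type u} [AddCommGroup S] [AddCommGroup T]
    (hS : IsRankOne S) (hT : IsRankOne T) (h : hS.type = hT.type) :
    cogeneratedByGroup S = cogeneratedByGroup T :=
  le_antisymm ((cogeneratedByGroup_le_iff hT hS).2 h.ge) ((cogeneratedByGroup_le_iff hS hT).2 h.le)

end CotorsionTheory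

theorem exists_orderIso_rationalCotorsionTheory :
    ∃ Φ : GroupType ≃o (RationalCotorsionTheory.{u})ᵒᵈ,
      ∀ (T : Type u) [AddCommGroup T] (hT : IsRankOne T),
        (OrderDual.ofDual (Φ hT.type)).val = CotorsionTheory.cogeneratedByGroup T := by
  choose G hG hR htype using GroupType.exists_isRankOne.{u}
  let f : GroupType → (RationalCotorsionTheory.{u})ᵒᵈ := fun τ =>
    OrderDual.toDual ⟨CotorsionTheory.cogeneratedByGroup (G τ), G τ, hG τ, hR τ, rfl⟩
  have hf : ∀ (T : Type u) [AddCommGroup T] (hT : IsRankOne T),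
      (OrderDual.ofDual (f hT.type)).val = CotorsionTheory.cogeneratedByGroup T :=
    fun T _ hT => CotorsionTheory.cogeneratedByGroup_eq (hR _) hT (htype _)
  have hle : ∀ σ τ : GroupType, f σ ≤ f τ ↔ σ ≤ τ := fun σ τ =>
    (CotorsionTheory.cogeneratedByGroup_le_iff (hR σ) (hR τ)).trans (by rw [htype, htype])
  have hsurj : Function.Surjective f := by
    rintro ⟨P, T, _, hT, rfl⟩
    exact ⟨hT.type, Subtype.ext (hf T hT)⟩
  exact ⟨RelIso.ofSurjective (OrderEmbedding.ofMapLEIff f hle) hsurj, hf⟩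

theorem theorem1p11 :
    ∃ Φ : GroupType ≃o (RationalCotorsionTheory.{u})ᵒᵈ,
      (∀ (T : Type u) [AddCommGroup T] (hT : IsRankOne T),
        (OrderDual.ofDual (Φ hT.type)).val = CotorsionTheory.cogeneratedByGroup T) ∧
      (∀ σ τ : GroupType,
        IsGLB {OrderDual.ofDual (Φ σ), OrderDual.ofDual (Φ τ)} (OrderDual.ofDual (Φ (σ ⊔ τ))) ∧
        IsLUB {OrderDual.ofDual (Φ σ), OrderDual.ofDual (Φ τ)} (OrderDual.ofDual (Φ (σ ⊓ τ)))) := by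
  obtain ⟨Φ, hΦ⟩ := exists_orderIso_rationalCotorsionTheory.{u}
  refine ⟨Φ, hΦ, fun σ τ => ⟨?_, ?_⟩⟩
  · have h := Φ.isLUB_image'.2 (isLUB_pair (a := σ) (b := τ))
    rwa [Set.image_pair] at h
  · have h := Φ.isGLB_image'.2 (isGLB_pair (a := σ) (b := τ))
    rwa [Set.image_pair] at h
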